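/- Let $n\ge 1$, let $g_1,\dots,g_n\in\mathbb{C}[z]$ be polynomials, and let $f:\mathbb{C}\to X:=\{[1:\zeta_1:\cdots:\zeta_n]\in\mathbb{C}P^n \mid \zeta_i\neq 0 \text{ for all } i\}$ be the holomorphic map \[ f(z)=[1:e^{g_1(z)}:\cdots:e^{g_n(z)}]. \] Equip $X$ with the restriction of the Fubini–Study metric of $\mathbb{C}P^n$, normalized so that in the affine coordinates $\zeta$ its Hermitian matrix is $\frac1\pi\,\frac{\partial^2}{\partial\zeta_i\,\partial\bar\zeta_j}\log\bigl(1+\sum_k|\zeta_k|^2\bigr)$, and put $|df|(z):=\sqrt2\,|df(\partial/\partial z)|$, where $\partial/\partial z=\frac12(\partial/\partial x-\sqrt{-1}\,\partial/\partial y)$; equivalently, \[ |df|^2(z)=\frac1{4\pi}\,\Delta\log\Bigl(1+\sum_{i=1}^n|e^{g_i(z)}|^2\Bigr),\qquad \Delta=\frac{\partial^2}{\partial x^2}+\frac{\partial^2}{\partial y^2}. \] Define the integer $m\ge -1$ by $m+1=\max(\deg g_1,\dots,\deg g_n)$, where constant polynomials, including $0$, have degree $0$. If $m\ge 0$ (that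 is, if $f$ is not constant), then \[ \limsup_{r\to\infty}\frac{\max_{|z|=r}\log|df|(z)}{\log r}=m, \] where $\log 0=-\infty$ and, for each $r>0$, the maximum over the circle $|z|=r$ is attained. -/

import Mathlib

open scoped LinearAlgebra.Projectivization

noncomputable section

namespace TorusCurve

/-- The vector `(1, ζ₁, …, ζₙ)` of homogeneous coordinates. -/
def homog {n : ℕ} (ζ : Fin n → ℂ) : Fin (n + 1) → ℂ := Fin.cons 1 ζ

theorem homog_ne_zero {n : ℕ} (ζ : Fin n → ℂ) : homog ζ ≠ 0 := by
  intro h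
  have h0 := congrFun h 0
  simp [homog] at h0

/-- The point `[1 : ζ₁ : ⋯ : ζₙ]` of `ℂPⁿ`. -/
def point {n : ℕ} (ζ : Fin n → ℂ) : ℙ ℂ (Fin (n + 1) → ℂ) :=
  Projectivization.mk ℂ (homog ζ) (homog_ne_zero ζ)

/-- `X = {[1 : ζ₁ : ⋯ : ζₙ] | ζᵢ ≠ 0 for all i} ⊆ ℂPⁿ`. -/
def X (n : ℕ) : Set (ℙ ℂ (Fin (n + 1) → ℂ)) :=
  {p | ∃ ζ : Fin n → ℂ, (∀ i, ζ i ≠ 0) ∧ p = point ζ}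

/-- The affine coordinates `[w₀ : ⋯ : wₙ] ↦ (w₁ / w₀, …, wₙ / w₀)`, a holomorphic chart on
`{w₀ ≠ 0}`, which contains `X n`. -/
def affineCoord {n : ℕ} : ℙ ℂ (Fin (n + 1) → ℂ) → (Fin n → ℂ) :=
  Projectivization.lift (fun w i => w.1 i.succ / w.1 0) (by
    rintro ⟨a, ha⟩ ⟨b, hb⟩ t h
    simp only at h
    have ht : t ≠ 0 := by
      rintro rfl
      exact ha (by simp [h])
    funext i
    simp only [h, Pi.smul_apply, smul_eq_mul]
    exact mul_div_mul_left _ _ ht)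

theorem affineCoord_point {n : ℕ} (ζ : Fin n → ℂ) : affineCoord (point ζ) = ζ := by
  funext i
  simp [affineCoord, point, homog]

/-- The Fubini–Study metric of `ℂPⁿ` in the affine coordinates, as a Riemannian metric: the inner
product, at the point with coordinates `ζ`, of the tangent vectors with coordinates `v` and `w`.
It is the real part of the Hermitian form with matrix
`(1 / π) ∂²/∂ζᵢ∂ζ̄ⱼ log (1 + ∑ |ζₖ|²)`. -/
def fubiniStudy {n : ℕ} (ζ v w : Fin n → ℂ) : ℝ :=
  (1 / Real.pi) *
    ((1 + ∑ i, ‖ζ i‖ ^ 2) * (∑ i, v i * star (w i)).re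
      - ((∑ i, v i * star (ζ i)) * (∑ i, ζ i * star (w i))).re)
    / (1 + ∑ i, ‖ζ i‖ ^ 2) ^ 2

/-- The norm of the complexified tangent vector `a + √-1 b` (with `a`, `b` real tangent vectors at
`ζ`) for the Hermitian extension of the Fubini–Study metric. -/
def complexifiedNorm {n : ℕ} (ζ a b : Fin n → ℂ) : ℝ :=
  √(fubiniStudy ζ a a + fubiniStudy ζ b b)

/-- `|df|(z) = √2 |df(∂/∂z)|`, with `∂/∂z = (1/2) (∂/∂x - √-1 ∂/∂y)`. -/
def normDf {n : ℕ} (f : ℂ → X n) (z : ℂ) : ℝ :=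
  let F : ℂ → (Fin n → ℂ) := fun u => affineCoord (f u).1
  √2 * complexifiedNorm (F z)
    ((1 / 2 : ℝ) • fderiv ℝ F z 1) (-(1 / 2 : ℝ) • fderiv ℝ F z Complex.I)

/-- The map `z ↦ [1 : exp (g₁ z) : ⋯ : exp (gₙ z)]`. -/
def expCurve {n : ℕ} (g : Fin n → Polynomial ℂ) (z : ℂ) : X n :=
  ⟨point fun i => Complex.exp ((g i).eval z),
    fun i => Complex.exp ((g i).eval z), fun _ => Complex.exp_ne_zero _, rfl⟩

/-- `log |df|(z)`, with the value `-∞` where `|df|(z) = 0`. -/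
def logNormDf {n : ℕ} (f : ℂ → X n) (z : ℂ) : EReal :=
  ENNReal.log (ENNReal.ofReal (normDf f z))

/-- `max_{|z| = r} log |df|(z)`. -/
def maxLogNormDf {n : ℕ} (f : ℂ → X n) (r : ℝ) : EReal :=
  ⨆ z ∈ Metric.sphere (0 : ℂ) r, logNormDf f z

end TorusCurve

end

/-!
Write `Z = (1, e^{g₁}, …, e^{gₙ})`. By the Lagrange identity, `|df|²` is `1 / π` times the variance
of the logarithmic derivatives `0, g₁', …, gₙ'` under the probability weights `|Zᵢ|² / |Z|²`. The
logarithmic derivatives are `O(|z|^m)`, which bounds `|df|` above. For the lower bound, the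
exponents that dominate in real part near one point of a large circle do not dominate all around
it, so by connectedness the circle contains a point where the maximum of the `|Zᵢ|` is attained by
two coordinates whose exponents have different coefficients of `z^(m + 1)`. There both weights are
at least `1 / (n + 1)`, while the difference of the two logarithmic derivatives has size at least
a constant times `|z|^m`. Hence the quotient in question even converges to `m`.
-/

open Bornology Filter Polynomial Topology

theorem sum_sum_norm_mul_sub_mul_sq {𝕜 ι : Type*} [RCLike 𝕜] [Fintype ι] (z w : ι → 𝕜) :
    ∑ i, ∑ j, ‖z i * w j - z j * w i‖ ^ 2 =
      2 * ((∑ i, ‖z i‖ ^ 2) * ∑ i, ‖w i‖ ^ 2 - ‖∑ i, w i * star (z i)‖ ^ 2) := by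
  have cast_sq_norm (a : 𝕜) : ((‖a‖ ^ 2 : ℝ) : 𝕜) = a * star a := by
    rw [RCLike.star_def, RCLike.mul_conj, RCLike.ofReal_pow]
  have expand (i j : ι) : (z i * w j - z j * w i) * star (z i * w j - z j * w i) =
      z i * star (z i) * (w j * star (w j)) + w i * star (w i) * (z j * star (z j)) -
        (w i * star (z i) * (z j * star (w j)) + z i * star (w i) * (w j * star (z j))) := by
    simp only [star_sub, star_mul']
    ring
  have star_sum_mul : star (∑ i, w i * star (z i)) = ∑ i, z i * star (w i) := by
    simp only [star_sum, star_mul', star_star, mul_comm]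
  refine RCLike.ofReal_injective (K := 𝕜) ?_
  simp only [map_sum, map_mul, map_sub, map_ofNat, cast_sq_norm, star_sum_mul, expand,
    Finset.sum_sub_distrib, Finset.sum_add_distrib, ← Finset.mul_sum, ← Finset.sum_mul]
  ring

section Softmax

variable {ι : Type*} [Fintype ι]

/-- The probability vector on `ι` proportional to `exp ∘ x`. -/
noncomputable def softmax (x : ι → ℝ) (i : ι) : ℝ := Real.exp (x i) / ∑ j, Real.exp (x j)

theorem softmax_nonneg (x : ι → ℝ) (i : ι) : 0 ≤ softmax x i := by
  unfold softmax
  positivity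

theorem sum_exp_pos [Nonempty ι] (x : ι → ℝ) : 0 < ∑ i, Real.exp (x i) :=
  Finset.sum_pos (fun i _ => Real.exp_pos (x i)) Finset.univ_nonempty

theorem sum_softmax [Nonempty ι] (x : ι → ℝ) : ∑ i, softmax x i = 1 := by
  simp only [softmax, ← Finset.sum_div]
  exact div_self (sum_exp_pos x).ne'

theorem inv_card_le_softmax [Nonempty ι] {x : ι → ℝ} {i : ι} (hi : ∀ j, x j ≤ x i) :
    (Fintype.card ι : ℝ)⁻¹ ≤ softmax x i := by
  rw [softmax, le_div_iff₀ (sum_exp_pos x), inv_mul_le_iff₀ (by positivity)]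
  simpa using Finset.sum_le_card_nsmul Finset.univ (fun j => Real.exp (x j)) (Real.exp (x i))
    fun j _ => Real.exp_le_exp.2 (hi j)

theorem continuous_softmax [Nonempty ι] : Continuous (softmax : (ι → ℝ) → ι → ℝ) :=
  continuous_pi fun i => by
    unfold softmax
    exact Continuous.div (by fun_prop) (by fun_prop) fun x => (sum_exp_pos x).ne'

end Softmax

theorem norm_cexp_sq (w : ℂ) : ‖Complex.exp w‖ ^ 2 = Real.exp (2 * w.re) := by
  rw [Complex.norm_exp, ← Real.exp_nat_mul, Nat.cast_ofNat]

theorem tendsto_log_mul_pow_div_log {c : ℝ} (hc : c ≠ 0) (m : ℕ) :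
    Tendsto (fun r : ℝ => (Real.log (c * r ^ m) : EReal) / (Real.log r : EReal)) atTop
      (𝓝 (m : EReal)) := by
  have tendsto_real : Tendsto (fun r : ℝ => Real.log c / Real.log r + m) atTop (𝓝 m) := by
    simpa using (Real.tendsto_log_atTop.const_div_atTop (Real.log c)).add_const (m : ℝ)
  refine ((continuous_coe_real_ereal.tendsto (m : ℝ)).comp tendsto_real).congr' ?_
  filter_upwards [eventually_gt_atTop 1] with r hr
  have log_ne_zero : Real.log r ≠ 0 := (Real.log_pos hr).ne'
  rw [← EReal.coe_div, Function.comp_apply, Real.log_mul hc (by positivity), Real.log_pow,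
    add_div, mul_div_cancel_right₀ _ log_ne_zero]

/-- The points where the maximum is attained in `A` and those where it is attained outside `A` form
a closed cover of `s`. -/
theorem exists_isMax_mem_and_isMax_notMem {ι S α : Type*} [Finite ι] [TopologicalSpace S]
    [LinearOrder α] [TopologicalSpace α] [OrderClosedTopology α] {s : Set S} (hs : IsPreconnected s)
    {x : ι → S → α} (hx : ∀ i, Continuous (x i)) {A : Set ι}
    (hA : ∃ p ∈ s, ∃ i ∈ A, ∀ l, x l p ≤ x i p) (hAc : ∃ p ∈ s, ∃ i ∉ A, ∀ l, x l p ≤ x i p) :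
    ∃ p ∈ s, (∃ i ∈ A, ∀ l, x l p ≤ x i p) ∧ ∃ j ∉ A, ∀ l, x l p ≤ x j p := by
  have isClosed_max (B : Set ι) : IsClosed {p | ∃ i ∈ B, ∀ l, x l p ≤ x i p} := by
    simp only [Set.ofPred_exists, Set.ofPred_and, Set.ofPred_forall]
    exact isClosed_iUnion_of_finite fun i => isClosed_const.inter
      (isClosed_iInter fun l => isClosed_le (hx l) (hx i))
  refine isPreconnected_closed_iff.1 hs _ _ (isClosed_max A) (isClosed_max Aᶜ) (fun p _ => ?_)
    hA hAc
  obtain ⟨-, -, i₀, -⟩ := hA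
  have : Nonempty ι := ⟨i₀⟩
  obtain ⟨i, hi⟩ := Finite.exists_max fun l => x l p
  exact (em (i ∈ A)).imp (fun h => ⟨i, h, hi⟩) fun h => ⟨i, h, hi⟩

theorem re_mul_star_lt_of_norm_le {a b : ℂ} (hab : ‖b‖ ≤ ‖a‖) (hne : b ≠ a) :
    (b * star a).re < (a * star a).re := by
  have norm_sub_sq_pos : 0 < ‖b - a‖ ^ 2 := pow_pos (norm_pos_iff.2 (sub_ne_zero.2 hne)) 2
  have norm_sq_le : ‖b‖ ^ 2 ≤ ‖a‖ ^ 2 := by gcongr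
  simp only [Complex.sq_norm, Complex.normSq_apply, Complex.sub_re, Complex.sub_im,
    Complex.star_def, Complex.mul_re, Complex.conj_re, Complex.conj_im] at *
  linarith

section LeadingCoefficients

variable {𝕜 ι : Type*} [NormedField 𝕜] [Finite ι] {k : ℕ}

theorem tendsto_eval_div_pow_cobounded {P : 𝕜[X]} (hP : P.natDegree ≤ k) :
    Tendsto (fun z => P.eval z / z ^ k) (cobounded 𝕜) (𝓝 (P.coeff k)) := by
  have eval_reflect_zero : (reflect k P).eval 0 = P.coeff k := by
    rw [← coeff_zero_eq_eval_zero, coeff_reflect, revAt_le k.zero_le, Nat.sub_zero]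
  have tendsto_reflect : Tendsto (fun z => (reflect k P).eval z⁻¹) (cobounded 𝕜)
      (𝓝 (P.coeff k)) := by
    rw [← eval_reflect_zero]
    exact ((reflect k P).continuous.tendsto 0).comp tendsto_inv₀_cobounded
  refine tendsto_reflect.congr' ?_
  filter_upwards [eventually_ne_cobounded (0 : 𝕜)] with z hz
  have : Invertible z := invertibleOfNonzero hz
  rw [eq_div_iff (pow_ne_zero k hz), ← invOf_eq_inv]
  exact eval₂_reflect_mul_pow (RingHom.id 𝕜) z k P hP

theorem exists_eventually_norm_eval_le {P : ι → 𝕜[X]} (hP : ∀ i, (P i).natDegree ≤ k) :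
    ∃ C : ℝ, 0 < C ∧ ∀ᶠ z in cobounded 𝕜, ∀ i, ‖(P i).eval z‖ ≤ C * ‖z‖ ^ k := by
  obtain ⟨C, hC, coeff_lt⟩ := ((eventually_gt_atTop (0 : ℝ)).and
    (eventually_all.2 fun i => eventually_gt_atTop ‖(P i).coeff k‖)).exists
  refine ⟨C, hC, eventually_all.2 fun i => ?_⟩
  filter_upwards [eventually_ne_cobounded (0 : 𝕜),
    (tendsto_eval_div_pow_cobounded (hP i)).norm.eventually_le_const (coeff_lt i)] with z hz hle
  rwa [norm_div, norm_pow, div_le_iff₀ (pow_pos (norm_pos_iff.2 hz) k)] at hle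

theorem exists_eventually_le_norm_eval {P : ι → 𝕜[X]} (hP : ∀ i, (P i).natDegree ≤ k) :
    ∃ c : ℝ, 0 < c ∧ ∀ᶠ z in cobounded 𝕜, ∀ i, (P i).coeff k ≠ 0 →
      c * ‖z‖ ^ k ≤ ‖(P i).eval z‖ := by
  obtain ⟨c, lt_coeff, hc⟩ : ∃ c : ℝ, (∀ i, (P i).coeff k ≠ 0 → c < ‖(P i).coeff k‖) ∧ 0 < c :=
    ((eventually_all.2 fun i => eventually_imp_distrib_left.2 fun hi =>
      nhdsWithin_le_nhds (eventually_lt_nhds (norm_pos_iff.2 hi))).and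
      (self_mem_nhdsWithin (s := Set.Ioi (0 : ℝ)))).exists
  refine ⟨c, hc, eventually_all.2 fun i => eventually_imp_distrib_left.2 fun hi => ?_⟩
  filter_upwards [eventually_ne_cobounded (0 : 𝕜),
    (tendsto_eval_div_pow_cobounded (hP i)).norm.eventually_const_le (lt_coeff i hi)] with z hz hle
  rwa [norm_div, norm_pow, le_div_iff₀ (pow_pos (norm_pos_iff.2 hz) k)] at hle

theorem eventually_re_eval_lt_on_ray {P Q : ℂ[X]} (hP : P.natDegree ≤ k) (hQ : Q.natDegree ≤ k)
    {w : ℂ} (hw : w ≠ 0) (hlt : (P.coeff k * w ^ k).re < (Q.coeff k * w ^ k).re) :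
    ∀ᶠ t : ℝ in atTop, (P.eval (t * w)).re < (Q.eval (t * w)).re := by
  have tendsto_ray : Tendsto (fun t : ℝ => (t : ℂ) * w) atTop (cobounded ℂ) :=
    (tendsto_mul_right_cobounded hw).comp (RCLike.tendsto_ofReal_atTop_cobounded ℂ)
  have tendsto_re {R : ℂ[X]} (hR : R.natDegree ≤ k) :
      Tendsto (fun t : ℝ => (R.eval (t * w)).re / t ^ k) atTop
        (𝓝 (R.coeff k * w ^ k).re) := by
    refine ((Complex.continuous_re.tendsto _).comp
      (((tendsto_eval_div_pow_cobounded hR).comp tendsto_ray).mul_const (w ^ k))).congr fun t => ?_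
    rw [Function.comp_apply, Function.comp_apply, mul_pow, ← div_div,
      div_mul_cancel₀ _ (pow_ne_zero k hw), ← Complex.ofReal_pow, Complex.div_ofReal_re]
  filter_upwards [(tendsto_re hP).eventually_lt (tendsto_re hQ) hlt, eventually_gt_atTop 0]
    with t ht ht0
  exact (div_lt_div_iff_of_pos_right (pow_pos ht0 k)).1 ht

theorem eventually_exists_forall_re_eval_lt {G : ι → ℂ[X]} (hG : ∀ i, (G i).natDegree ≤ k)
    (hk : k ≠ 0) {u : ℂ} (hu : u ≠ 0) :
    ∀ᶠ r : ℝ in atTop, ∃ z ∈ Metric.sphere (0 : ℂ) r, ∀ i j,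
      ((G i).coeff k * u).re < ((G j).coeff k * u).re →
        ((G i).eval z).re < ((G j).eval z).re := by
  obtain ⟨w, rfl⟩ := IsAlgClosed.exists_pow_nat_eq u hk.pos
  have hw : w ≠ 0 := ne_zero_pow hk hu
  have eventually_lt : ∀ᶠ t : ℝ in atTop, ∀ i j,
      ((G i).coeff k * w ^ k).re < ((G j).coeff k * w ^ k).re →
        ((G i).eval (t * w)).re < ((G j).eval (t * w)).re :=
    eventually_all.2 fun i => eventually_all.2 fun j => eventually_imp_distrib_left.2
      (eventually_re_eval_lt_on_ray (hG i) (hG j) hw)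
  filter_upwards [(tendsto_id.atTop_div_const (norm_pos_iff.2 hw)).eventually eventually_lt,
    eventually_ge_atTop 0] with r hr hr0
  refine ⟨(r / ‖w‖ : ℝ) * w, ?_, hr⟩
  rw [mem_sphere_zero_iff_norm, norm_mul, Complex.norm_real, Real.norm_of_nonneg (by positivity),
    div_mul_cancel₀ r (norm_ne_zero_iff.2 hw)]

/-- Let `a` be a leading coefficient of largest modulus. The members with leading coefficient `a`
dominate where `zᵏ` has the argument of `star a` and are dominated where it has the opposite one, so
there is a tie somewhere in between. -/
theorem eventually_exists_tie_re_eval {G : ι → ℂ[X]} (hG : ∀ i, (G i).natDegree ≤ k) (hk : k ≠ 0)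
    (hne : ∃ i j, (G i).coeff k ≠ (G j).coeff k) :
    ∀ᶠ r : ℝ in atTop, ∃ z ∈ Metric.sphere (0 : ℂ) r, ∃ i j, (G i).coeff k ≠ (G j).coeff k ∧
      (∀ l, ((G l).eval z).re ≤ ((G i).eval z).re) ∧
      ∀ l, ((G l).eval z).re ≤ ((G j).eval z).re := by
  obtain ⟨i₀, j₀, hne⟩ := hne
  have : Nonempty ι := ⟨i₀⟩
  obtain ⟨i₁, norm_le⟩ := Finite.exists_max fun i => ‖(G i).coeff k‖
  set a := (G i₁).coeff k
  obtain ⟨j₁, hj₁⟩ : ∃ j, (G j).coeff k ≠ a := by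
    by_contra! h
    exact hne ((h i₀).trans (h j₀).symm)
  have lt_a {i : ι} (hi : (G i).coeff k ≠ a) : ((G i).coeff k * star a).re < (a * star a).re :=
    re_mul_star_lt_of_norm_le (norm_le i) hi
  have ha0 : star a ≠ 0 := by
    refine star_ne_zero.2 fun h => hj₁ ?_
    simpa [h] using norm_le j₁
  filter_upwards [eventually_exists_forall_re_eval_lt hG hk ha0,
    eventually_exists_forall_re_eval_lt hG hk (neg_ne_zero.2 ha0)]
    with r ⟨p, hp, lt_at_p⟩ ⟨q, hq, lt_at_q⟩
  obtain ⟨i, hi⟩ := Finite.exists_max fun l => ((G l).eval p).re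
  obtain ⟨j, hj⟩ := Finite.exists_max fun l => ((G l).eval q).re
  have coeff_i : (G i).coeff k = a := by
    by_contra h
    exact (lt_at_p i i₁ (lt_a h)).not_ge (hi i₁)
  have coeff_j : (G j).coeff k ≠ a := fun h => by
    refine (lt_at_q j j₁ ?_).not_ge (hj j₁)
    simpa only [h, mul_neg, Complex.neg_re, neg_lt_neg_iff] using lt_a hj₁
  have isPreconnected_circle : IsPreconnected (Metric.sphere (0 : ℂ) r) :=
    isPreconnected_sphere (by simp [Complex.rank_real_complex]) 0 r
  obtain ⟨z, hz, ⟨i', coeff_i', hi'⟩, j', coeff_j', hj'⟩ :=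
    exists_isMax_mem_and_isMax_notMem (A := {i | (G i).coeff k = a}) isPreconnected_circle
      (fun l => Complex.continuous_re.comp (G l).continuous)
      ⟨p, hp, i, coeff_i, hi⟩ ⟨q, hq, j, coeff_j, hj⟩
  exact ⟨z, hz, i', j', fun h => coeff_j' (h.symm.trans coeff_i'), hi', hj'⟩

end LeadingCoefficients

theorem exists_coeff_ne_zero_of_succ_eq_sup_natDegree {ι R : Type*} [Semiring R] {s : Finset ι}
    {P : ι → R[X]} {m : ℕ} (hm : m + 1 = s.sup fun i => (P i).natDegree) :
    ∃ i, (P i).coeff (m + 1) ≠ 0 := by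
  have lt_sup : m < s.sup fun i => (P i).natDegree := hm ▸ m.lt_succ_self
  obtain ⟨i, hi, hlt⟩ := Finset.lt_sup_iff.1 lt_sup
  have natDegree_eq : (P i).natDegree = m + 1 :=
    le_antisymm (hm ▸ Finset.le_sup (f := fun i => (P i).natDegree) hi) hlt
  refine ⟨i, ?_⟩
  rw [← natDegree_eq, coeff_natDegree, leadingCoeff_ne_zero]
  exact ne_zero_of_natDegree_gt hlt

namespace TorusCurve

section FubiniStudy

variable {n : ℕ}

/-- `Fin.cons 0 v` is the derivative of `homog` in the direction `v`, so the double sum is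
`2 |Z ∧ dZ|²` for the homogeneous coordinates `Z`. -/
theorem fubiniStudy_self (ζ v : Fin n → ℂ) :
    fubiniStudy ζ v v = (2 * Real.pi)⁻¹ *
      (∑ i, ∑ j, ‖homog ζ i * (Fin.cons 0 v : Fin (n + 1) → ℂ) j -
        homog ζ j * (Fin.cons 0 v : Fin (n + 1) → ℂ) i‖ ^ 2) / (∑ i, ‖homog ζ i‖ ^ 2) ^ 2 := by
  have mul_star (a : ℂ) : a * star a = ((‖a‖ ^ 2 : ℝ) : ℂ) := by
    rw [Complex.star_def, Complex.mul_conj, Complex.normSq_eq_norm_sq]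
  have star_sum_mul : ∑ i, ζ i * star (v i) = star (∑ i, v i * star (ζ i)) := by
    simp only [star_sum, star_mul', star_star, mul_comm]
  rw [sum_sum_norm_mul_sub_mul_sq, fubiniStudy, star_sum_mul]
  simp only [mul_star, ← Complex.ofReal_sum, Complex.ofReal_re]
  simp only [homog, Fin.sum_univ_succ, Fin.cons_zero, Fin.cons_succ, norm_one, norm_zero, zero_mul,
    one_pow, ne_eq, OfNat.ofNat_ne_zero, not_false_eq_true, zero_pow, zero_add]
  field_simp

theorem fubiniStudy_smul_self (c : ℂ) (ζ v : Fin n → ℂ) :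
    fubiniStudy ζ (c • v) (c • v) = ‖c‖ ^ 2 * fubiniStudy ζ v v := by
  have cons_smul : (Fin.cons 0 (c • v) : Fin (n + 1) → ℂ) = c • Fin.cons 0 v := by
    ext i
    cases i using Fin.cases <;> simp
  have norm_sq_factor (a b x y : ℂ) :
      ‖a * (c * x) - b * (c * y)‖ ^ 2 = ‖c‖ ^ 2 * ‖a * x - b * y‖ ^ 2 := by
    rw [← mul_pow, ← norm_mul]
    ring_nf
  simp only [fubiniStudy_self, cons_smul, Pi.smul_apply, smul_eq_mul, norm_sq_factor,
    ← Finset.mul_sum]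
  ring

theorem normDf_eq_sqrt_fubiniStudy {f : ℂ → X n} {z : ℂ} {v : Fin n → ℂ}
    (h : HasDerivAt (fun u => affineCoord (f u).1) v z) :
    normDf f z = √(fubiniStudy (affineCoord (f z).1) v v) := by
  have fderiv_apply (w : ℂ) : fderiv ℝ (fun u => affineCoord (f u).1) z w = w • v := by
    rw [(h.hasFDerivAt.restrictScalars ℝ).fderiv]
    simp
  have half_smul : (1 / 2 : ℝ) • ((1 : ℂ) • v) = (1 / 2 : ℂ) • v := by
    ext i
    simp
  have neg_half_smul : -(1 / 2 : ℝ) • (Complex.I • v) = (-(1 / 2) * Complex.I) • v := by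
    ext i
    simp [mul_assoc]
  have norm_sq_half : ‖(1 / 2 : ℂ)‖ ^ 2 = 1 / 4 := by norm_num
  have norm_sq_half_I : ‖-(1 / 2) * Complex.I‖ ^ 2 = 1 / 4 := by norm_num
  rw [normDf, complexifiedNorm, fderiv_apply, fderiv_apply, half_smul, neg_half_smul,
    fubiniStudy_smul_self, fubiniStudy_smul_self, norm_sq_half, norm_sq_half_I,
    ← Real.sqrt_mul zero_le_two]
  ring_nf

end FubiniStudy

section ExpCurve

variable {n : ℕ} (g : Fin n → ℂ[X]) (z : ℂ)

/-- The exponents `0, g₁, …, gₙ` of the homogeneous coordinates of `expCurve g`. -/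
noncomputable def exponents : Fin (n + 1) → ℂ[X] := Fin.cons 0 g

/-- The logarithmic derivatives at `z` of the homogeneous coordinates of `expCurve g`. -/
noncomputable def logDer (i : Fin (n + 1)) : ℂ := (derivative (exponents g i)).eval z

/-- The shares `|Zᵢ|² / ∑ⱼ |Zⱼ|²` of the homogeneous coordinates `Z` of `expCurve g z`, encoded as
a `softmax` since `|exp w|² = exp (2 Re w)`. -/
noncomputable def coordShare : Fin (n + 1) → ℝ :=
  softmax fun i => 2 * ((exponents g i).eval z).re

theorem homog_exp (i : Fin (n + 1)) :
    homog (fun j => Complex.exp ((g j).eval z)) i = Complex.exp ((exponents g i).eval z) := by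
  cases i using Fin.cases <;> simp [homog, exponents]

theorem cons_zero_deriv_exp (i : Fin (n + 1)) :
    (Fin.cons 0 fun j => Complex.exp ((g j).eval z) * (derivative (g j)).eval z :
      Fin (n + 1) → ℂ) i = Complex.exp ((exponents g i).eval z) * logDer g z i := by
  cases i using Fin.cases <;> simp [exponents, logDer]

theorem hasDerivAt_affineCoord_expCurve :
    HasDerivAt (fun u => affineCoord (expCurve g u).1)
      (fun i => Complex.exp ((g i).eval z) * (derivative (g i)).eval z) z := by
  simp only [expCurve, affineCoord_point]
  exact hasDerivAt_pi.2 fun i => ((g i).hasDerivAt z).cexp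

theorem normDf_expCurve :
    normDf (expCurve g) z = √((2 * Real.pi)⁻¹ * ∑ i, ∑ j,
      coordShare g z i * coordShare g z j * ‖logDer g z i - logDer g z j‖ ^ 2) := by
  rw [normDf_eq_sqrt_fubiniStudy (hasDerivAt_affineCoord_expCurve g z), fubiniStudy_self,
    mul_div_assoc]
  have norm_sq_wedge (a b x y : ℂ) : ‖Complex.exp a * (Complex.exp b * y) -
      Complex.exp b * (Complex.exp a * x)‖ ^ 2 =
      Real.exp (2 * a.re) * Real.exp (2 * b.re) * ‖x - y‖ ^ 2 := by
    rw [norm_sub_rev x y, ← norm_cexp_sq, ← norm_cexp_sq, ← mul_pow, ← mul_pow, ← norm_mul,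
      ← norm_mul]
    ring_nf
  simp only [expCurve, affineCoord_point, homog_exp, cons_zero_deriv_exp, norm_sq_wedge,
    norm_cexp_sq, Finset.sum_div, coordShare, softmax]
  refine congrArg (fun S => √((2 * Real.pi)⁻¹ * S))
    (Finset.sum_congr rfl fun i _ => Finset.sum_congr rfl fun j _ => ?_)
  ring

theorem continuous_normDf_expCurve : Continuous (normDf (expCurve g)) := by
  have continuous_coordShare : Continuous (coordShare g) :=
    continuous_softmax.comp (by fun_prop)
  have continuous_logDer : Continuous (logDer g) := by
    unfold logDer
    fun_prop
  rw [funext (normDf_expCurve g)]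
  fun_prop

variable {g z}

theorem normDf_expCurve_le {R : ℝ} (h : ∀ i j, ‖logDer g z i - logDer g z j‖ ≤ R) :
    normDf (expCurve g) z ≤ R / √(2 * Real.pi) := by
  have hR : 0 ≤ R := (norm_nonneg _).trans (h 0 0)
  have sum_le : ∑ i, ∑ j, coordShare g z i * coordShare g z j *
      ‖logDer g z i - logDer g z j‖ ^ 2 ≤ R ^ 2 :=
    calc _ ≤ ∑ i, ∑ j, coordShare g z i * coordShare g z j * R ^ 2 := by
          gcongr with i _ j _
          · exact mul_nonneg (softmax_nonneg _ i) (softmax_nonneg _ j)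
          · exact h i j
      _ = R ^ 2 := by
          simp only [← Finset.sum_mul, ← Finset.mul_sum, coordShare, sum_softmax, one_mul]
  rw [normDf_expCurve]
  calc _ ≤ √((2 * Real.pi)⁻¹ * R ^ 2) := by gcongr
    _ = R / √(2 * Real.pi) := by
        rw [Real.sqrt_mul (by positivity), Real.sqrt_inv, Real.sqrt_sq hR, inv_mul_eq_div]

theorem le_normDf_expCurve {i j : Fin (n + 1)}
    (hi : ∀ l, ((exponents g l).eval z).re ≤ ((exponents g i).eval z).re)
    (hj : ∀ l, ((exponents g l).eval z).re ≤ ((exponents g j).eval z).re) :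
    ‖logDer g z i - logDer g z j‖ / (√(2 * Real.pi) * (n + 1)) ≤ normDf (expCurve g) z := by
  have le_coordShare {a : Fin (n + 1)}
      (ha : ∀ l, ((exponents g l).eval z).re ≤ ((exponents g a).eval z).re) :
      ((n : ℝ) + 1)⁻¹ ≤ coordShare g z a := by
    simpa [coordShare] using
      inv_card_le_softmax fun l => mul_le_mul_of_nonneg_left (ha l) zero_le_two
  have term_nonneg (a b : Fin (n + 1)) : 0 ≤ coordShare g z a * coordShare g z b *
      ‖logDer g z a - logDer g z b‖ ^ 2 :=
    mul_nonneg (mul_nonneg (softmax_nonneg _ a) (softmax_nonneg _ b)) (sq_nonneg _)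
  rw [normDf_expCurve]
  refine Real.le_sqrt_of_sq_le ?_
  calc (‖logDer g z i - logDer g z j‖ / (√(2 * Real.pi) * (n + 1))) ^ 2
      = (2 * Real.pi)⁻¹ *
          (((n : ℝ) + 1)⁻¹ * ((n : ℝ) + 1)⁻¹ * ‖logDer g z i - logDer g z j‖ ^ 2) := by
        rw [div_pow, mul_pow, Real.sq_sqrt (by positivity)]
        field_simp
    _ ≤ (2 * Real.pi)⁻¹ *
          (coordShare g z i * coordShare g z j * ‖logDer g z i - logDer g z j‖ ^ 2) := by
        gcongr
        · exact softmax_nonneg _ i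
        · exact le_coordShare hi
        · exact le_coordShare hj
    _ ≤ (2 * Real.pi)⁻¹ * ∑ b,
          coordShare g z i * coordShare g z b * ‖logDer g z i - logDer g z b‖ ^ 2 := by
        gcongr
        exact Finset.single_le_sum (fun b _ => term_nonneg i b) (Finset.mem_univ j)
    _ ≤ (2 * Real.pi)⁻¹ * ∑ a, ∑ b,
          coordShare g z a * coordShare g z b * ‖logDer g z a - logDer g z b‖ ^ 2 := by
        refine mul_le_mul_of_nonneg_left ?_ (by positivity)
        exact Finset.single_le_sum
          (f := fun a => ∑ b, coordShare g z a * coordShare g z b *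
            ‖logDer g z a - logDer g z b‖ ^ 2)
          (fun a _ => Finset.sum_nonneg fun b _ => term_nonneg a b) (Finset.mem_univ i)

end ExpCurve

section Growth

variable {n m : ℕ} {g : Fin n → ℂ[X]}

theorem natDegree_exponents_le (hg : ∀ i, (g i).natDegree ≤ m) (i : Fin (n + 1)) :
    (exponents g i).natDegree ≤ m := by
  cases i using Fin.cases with
  | zero => simp [exponents]
  | succ i => simpa [exponents] using hg i

theorem logDer_sub_logDer (z : ℂ) (i j : Fin (n + 1)) :
    logDer g z i - logDer g z j = (derivative (exponents g i - exponents g j)).eval z := by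
  rw [logDer, logDer, derivative_sub, eval_sub]

theorem natDegree_derivative_exponents_sub_le (hg : ∀ i, (g i).natDegree ≤ m + 1)
    (i j : Fin (n + 1)) : (derivative (exponents g i - exponents g j)).natDegree ≤ m := by
  have natDegree_sub_le : (exponents g i - exponents g j).natDegree ≤ m + 1 :=
    (natDegree_sub_le_of_le (natDegree_exponents_le hg i) (natDegree_exponents_le hg j)).trans
      (max_self _).le
  exact (natDegree_derivative_le _).trans (Nat.sub_le_of_le_add natDegree_sub_le)

theorem exists_eventually_normDf_expCurve_le (hg : ∀ i, (g i).natDegree ≤ m + 1) :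
    ∃ C : ℝ, 0 < C ∧ ∀ᶠ z in cobounded ℂ, normDf (expCurve g) z ≤ C * ‖z‖ ^ m := by
  obtain ⟨C, hC, hle⟩ := exists_eventually_norm_eval_le
    fun q : Fin (n + 1) × Fin (n + 1) => natDegree_derivative_exponents_sub_le hg q.1 q.2
  refine ⟨C / √(2 * Real.pi), by positivity, ?_⟩
  filter_upwards [hle] with z hz
  rw [div_mul_eq_mul_div]
  exact normDf_expCurve_le fun i j => (logDer_sub_logDer z i j).symm ▸ hz (i, j)

theorem exists_eventually_exists_le_normDf_expCurve (hg : ∀ i, (g i).natDegree ≤ m + 1)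
    (hne : ∃ i, (g i).coeff (m + 1) ≠ 0) :
    ∃ c : ℝ, 0 < c ∧ ∀ᶠ r : ℝ in atTop, ∃ z ∈ Metric.sphere (0 : ℂ) r,
      c * r ^ m ≤ normDf (expCurve g) z := by
  obtain ⟨c, hc, hle⟩ := exists_eventually_le_norm_eval
    fun q : Fin (n + 1) × Fin (n + 1) => natDegree_derivative_exponents_sub_le hg q.1 q.2
  obtain ⟨i₁, hi₁⟩ := hne
  have tie := eventually_exists_tie_re_eval (natDegree_exponents_le hg) m.succ_ne_zero
    ⟨i₁.succ, 0, by simpa [exponents] using hi₁⟩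
  rw [← comap_norm_atTop, eventually_comap] at hle
  refine ⟨c / (√(2 * Real.pi) * (n + 1)), by positivity, ?_⟩
  filter_upwards [hle, tie] with r hr ⟨z, hz, i, j, hij, hi, hj⟩
  refine ⟨z, hz, le_trans ?_ (le_normDf_expCurve hi hj)⟩
  have coeff_ne : (derivative (exponents g i - exponents g j)).coeff m ≠ 0 := by
    rw [coeff_derivative, coeff_sub]
    exact mul_ne_zero (sub_ne_zero.2 hij) m.cast_add_one_ne_zero
  have norm_z : ‖z‖ = r := mem_sphere_zero_iff_norm.1 hz
  rw [div_mul_eq_mul_div, logDer_sub_logDer, ← norm_z]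
  gcongr
  exact hr z norm_z (i, j) coeff_ne

end Growth

section MaxLogNormDf

variable {n m : ℕ} {f : ℂ → X n}

theorem isGreatest_maxLogNormDf (hf : Continuous (normDf f)) {r : ℝ} (hr : 0 ≤ r) :
    IsGreatest (logNormDf f '' Metric.sphere (0 : ℂ) r) (maxLogNormDf f r) := by
  have continuous_logNormDf : Continuous (logNormDf f) :=
    ENNReal.continuous_log.comp (ENNReal.continuous_ofReal.comp hf)
  rw [maxLogNormDf, ← sSup_image]
  exact ((isCompact_sphere 0 r).image continuous_logNormDf).isGreatest_sSup
    ((NormedSpace.sphere_nonempty.2 hr).image _)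

theorem coe_log_le_logNormDf {a : ℝ} (ha : 0 < a) {z : ℂ} (h : a ≤ normDf f z) :
    (Real.log a : EReal) ≤ logNormDf f z := by
  rw [← ENNReal.log_ofReal_of_pos ha]
  exact ENNReal.log_monotone (ENNReal.ofReal_le_ofReal h)

theorem logNormDf_le_coe_log {a : ℝ} (ha : 0 < a) {z : ℂ} (h : normDf f z ≤ a) :
    logNormDf f z ≤ (Real.log a : EReal) := by
  rw [← ENNReal.log_ofReal_of_pos ha]
  exact ENNReal.log_monotone (ENNReal.ofReal_le_ofReal h)

theorem tendsto_maxLogNormDf_div_log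
    (hle : ∃ C : ℝ, 0 < C ∧ ∀ᶠ z in cobounded ℂ, normDf f z ≤ C * ‖z‖ ^ m)
    (hge : ∃ c : ℝ, 0 < c ∧ ∀ᶠ r : ℝ in atTop, ∃ z ∈ Metric.sphere (0 : ℂ) r,
      c * r ^ m ≤ normDf f z) :
    Tendsto (fun r : ℝ => maxLogNormDf f r / (Real.log r : EReal)) atTop (𝓝 (m : EReal)) := by
  obtain ⟨C, hC, hle⟩ := hle
  obtain ⟨c, hc, hge⟩ := hge
  rw [← comap_norm_atTop, eventually_comap] at hle
  refine tendsto_of_tendsto_of_tendsto_of_le_of_le' (tendsto_log_mul_pow_div_log hc.ne' m)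
    (tendsto_log_mul_pow_div_log hC.ne' m) ?_ ?_
  · filter_upwards [hge, eventually_gt_atTop 1] with r ⟨z, hz, hcz⟩ hr
    refine EReal.div_le_div_right_of_nonneg (EReal.coe_nonneg.2 (Real.log_pos hr).le) ?_
    exact (coe_log_le_logNormDf (by positivity) hcz).trans
      (le_iSup₂ (f := fun z _ => logNormDf f z) z hz)
  · filter_upwards [hle, eventually_gt_atTop 1] with r hCr hr
    refine EReal.div_le_div_right_of_nonneg (EReal.coe_nonneg.2 (Real.log_pos hr).le) ?_
    refine iSup₂_le fun z hz => logNormDf_le_coe_log (by positivity) ?_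
    have norm_z : ‖z‖ = r := mem_sphere_zero_iff_norm.1 hz
    exact norm_z ▸ hCr z norm_z

end MaxLogNormDf

end TorusCurve

theorem theorem2_general {n : ℕ} (g : Fin n → ℂ[X]) (m : ℕ)
    (hm : m + 1 = Finset.univ.sup fun i => (g i).natDegree) :
    (∀ r : ℝ, 0 ≤ r →
      IsGreatest (TorusCurve.logNormDf (TorusCurve.expCurve g) '' Metric.sphere (0 : ℂ) r)
        (TorusCurve.maxLogNormDf (TorusCurve.expCurve g) r)) ∧
    Tendsto
      (fun r : ℝ => TorusCurve.maxLogNormDf (TorusCurve.expCurve g) r / (Real.log r : EReal))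
      atTop (𝓝 (m : EReal)) := by
  have natDegree_le (i : Fin n) : (g i).natDegree ≤ m + 1 :=
    hm ▸ Finset.le_sup (f := fun i => (g i).natDegree) (Finset.mem_univ i)
  exact ⟨fun r hr => TorusCurve.isGreatest_maxLogNormDf
      (TorusCurve.continuous_normDf_expCurve g) hr,
    TorusCurve.tendsto_maxLogNormDf_div_log
      (TorusCurve.exists_eventually_normDf_expCurve_le natDegree_le)
      (TorusCurve.exists_eventually_exists_le_normDf_expCurve natDegree_le
        (exists_coeff_ne_zero_of_succ_eq_sup_natDegree hm))⟩

theorem theorem2 {n : ℕ} (g : Fin n → Polynomial ℂ) (m : ℕ)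
    (hm : m + 1 = Finset.univ.sup fun i => (g i).natDegree) :
    (∀ r : ℝ, 0 < r →
      IsGreatest (TorusCurve.logNormDf (TorusCurve.expCurve g) '' Metric.sphere (0 : ℂ) r)
        (TorusCurve.maxLogNormDf (TorusCurve.expCurve g) r)) ∧
    Filter.limsup
      (fun r : ℝ => TorusCurve.maxLogNormDf (TorusCurve.expCurve g) r / (Real.log r : EReal))
      Filter.atTop = (m : EReal) := by
  obtain ⟨isGreatest, tendsto⟩ := theorem2_general g m hm
  exact ⟨fun r hr => isGreatest r hr.le, tendsto.limsup_eq⟩
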